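/- Let $\mathbb{D}$ be the open unit disc and let $\mathrm{Hol}(\mathbb{D})$ be the complex vector space of all holomorphic functions on $\mathbb{D}$. For $p\in\{1,2,3,\dots\}$ and $f\in\mathrm{Hol}(\mathbb{D})$ put \[ \|f\|_{\infty,1-1/p}=\sup_{|z|\le 1-1/p}|f(z)|, \] and consider on $\mathrm{Hol}(\mathbb{D})$ the two standard Fréchet metrics \[ d(f,g)=\sum_{p=1}^{\infty}2^{-p}\min\bigl(1,\|f-g\|_{\infty,1-1/p}\bigr),\qquad d'(f,g)=\sum_{p=1}^{\infty}2^{-p}\,\frac{\|f-g\|_{\infty,1-1/p}}{1+\|f-g\|_{\infty,1-1/p}}. \] Let $T:\mathrm{Hol}(\mathbb{D})\to\mathrm{Hol}(\mathbb{D})$ be a linear operator (continuity is not assumed). For $\alpha,\beta\in\mathbb{C}$ with $|\alpha|=|\beta|=1$ let $T_{\alpha,\beta}$ be the operator $(T_{\alpha,\beta}f)(z)=\alpha f(\beta z)$ on $\mathrm{Hol}(\mathbb{D})$. Then: 1. $T$ is an isometry for $d$, that is, $d(Tf,Tg)=d(f,g)$ for all $f,g$, if and only if $T=T_{\alpha,\beta}$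 for some $\alpha,\beta$ with $|\alpha|=|\beta|=1$. 2. $T$ is an isometry for $d'$ if and only if $T=T_{\alpha,\beta}$ for some $\alpha,\beta$ with $|\alpha|=|\beta|=1$. 3. $\|Tf\|_{\infty,1-1/p}=\|f\|_{\infty,1-1/p}$ for all $p\ge 1$ and all $f$ if and only if $T=T_{\alpha,\beta}$ for some $\alpha,\beta$ with $|\alpha|=|\beta|=1$. -/

import Mathlib

open scoped Complex.UnitDisc

/-- `Hol(𝔻)`: the complex vector space of all holomorphic functions on the open unit disc, as
functions on the type `𝔻` (so that equality is equality on the disc). -/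
def Hol : Submodule ℂ (𝔻 → ℂ) where
  carrier := {f | ∃ F : ℂ → ℂ, DifferentiableOn ℂ F (Metric.ball 0 1) ∧ ∀ z : 𝔻, f z = F z}
  zero_mem' := ⟨fun _ => 0, differentiableOn_const 0, fun _ => rfl⟩
  add_mem' := by
    rintro f g ⟨F, hF, hf⟩ ⟨G, hG, hg⟩
    exact ⟨fun z => F z + G z, hF.add hG, fun z => by simp [hf z, hg z]⟩
  smul_mem' := by
    rintro c f ⟨F, hF, hf⟩
    exact ⟨fun z => c * F z, hF.const_mul c, fun z => by simp [hf z]⟩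

/-- The seminorm `‖f‖_{∞,r} = sup_{|z| ≤ r} |f(z)|`, used only for `0 ≤ r < 1`, where the supremum
is over a nonempty compact subset of the disc. -/
noncomputable def supNorm (r : ℝ) (f : Hol) : ℝ :=
  ⨆ z : {z : 𝔻 // ‖(z : ℂ)‖ ≤ r}, ‖f.1 z.1‖

/-- The defining seminorms `‖f‖_{∞,1-1/p}` of the Fréchet space `Hol(𝔻)`, for `p ≥ 1`. -/
noncomputable def holNorm (p : ℕ) (f : Hol) : ℝ :=
  supNorm (1 - 1 / (p : ℝ)) f

/-- The standard Fréchet metric `∑_{p ≥ 1} 2^{-p} min(1, ‖f - g‖_{∞,1-1/p})`; the summation index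
is `k = p - 1`. -/
noncomputable def holDist (f g : Hol) : ℝ :=
  ∑' k : ℕ, (1 / 2 : ℝ) ^ (k + 1) * min 1 (holNorm (k + 1) (f - g))

/-- The other standard metric `∑_{p ≥ 1} 2^{-p} ‖f - g‖_{∞,1-1/p} / (1 + ‖f - g‖_{∞,1-1/p})`. -/
noncomputable def holDist' (f g : Hol) : ℝ :=
  ∑' k : ℕ, (1 / 2 : ℝ) ^ (k + 1) *
    (holNorm (k + 1) (f - g) / (1 + holNorm (k + 1) (f - g)))

/-- The operator `T_{α,β}` on `Hol(𝔻)`, `(T_{α,β} f)(z) = α f(β z)`, for `|α| = |β| = 1`. -/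
noncomputable def rotOp (α β : Circle) : Hol →ₗ[ℂ] Hol where
  toFun f := ⟨fun z => (α : ℂ) * f.1 (β • z), by
    obtain ⟨F, hF, hf⟩ := f.2
    refine ⟨fun z => (α : ℂ) * F (β * z), ?_, fun z => by simp [hf]⟩
    refine (hF.comp (differentiableOn_id.const_mul (β : ℂ)) ?_).const_mul (α : ℂ)
    intro z hz
    simpa [Circle.norm_coe] using hz⟩
  map_add' f g := by
    ext z
    simp [mul_add]
  map_smul' c f := by
    ext z
    simp [mul_left_comm]

/-! An isometry for either metric preserves every seminorm. By linearity `‖Tf‖` and `‖f‖` may be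
rescaled by any `t > 0`, and the resulting function of `t` determines the increasing sequence of
seminorms term by term: through the saturation of `min 1` for `d`, through the poles of its analytic
continuation for `d'`.

It remains to treat an operator preserving the suprema over radii `0 < r < s` and the value of
`|f(0)|`. The maximum principle makes `T 1` a unimodular constant `α` up to radius `r`, and equality
in the Schwarz lemma gives `T z = αβz` there. For `|z| = r` the functional `f ↦ α⁻¹ (Tf)(z)` is
unital, contractive and sends the coordinate to the boundary point `βz`; a peak function at that
point forces it to be evaluation there. Continuity of `T` never enters. -/

namespace Hol

/-! ### Suprema over closed discs -/

/-- A holomorphic function on the disc is bounded on each closed disc of radius `r < 1`. -/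
theorem bddAbove_range {r : ℝ} (hr : r < 1) (f : Hol) :
    BddAbove (Set.range fun z : {z : 𝔻 // ‖(z : ℂ)‖ ≤ r} => ‖f.1 z.1‖) := by
  obtain ⟨F, hF, hf⟩ := f.2
  have hc : ContinuousOn (fun z => ‖F z‖) (Metric.closedBall 0 r) :=
    (hF.continuousOn.mono (Metric.closedBall_subset_ball hr)).norm
  obtain ⟨M, hM⟩ := (isCompact_closedBall (0 : ℂ) r).bddAbove_image hc
  refine ⟨M, ?_⟩
  rintro _ ⟨z, rfl⟩
  refine hM ⟨z.1, by simpa using z.2, by simp [hf]⟩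

theorem norm_apply_le_supNorm {r : ℝ} (hr : r < 1) (f : Hol) {z : 𝔻} (hz : ‖(z : ℂ)‖ ≤ r) :
    ‖f.1 z‖ ≤ supNorm r f :=
  le_ciSup (bddAbove_range hr f) (⟨z, hz⟩ : {z : 𝔻 // ‖(z : ℂ)‖ ≤ r})

theorem supNorm_le {r M : ℝ} (hM : 0 ≤ M) {f : Hol} (h : ∀ z : 𝔻, ‖(z : ℂ)‖ ≤ r → ‖f.1 z‖ ≤ M) :
    supNorm r f ≤ M :=
  Real.iSup_le (fun z => h z.1 z.2) hM

theorem supNorm_nonneg (r : ℝ) (f : Hol) : 0 ≤ supNorm r f :=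
  Real.iSup_nonneg fun _ => norm_nonneg _

theorem supNorm_mono {r s : ℝ} (hrs : r ≤ s) (hs : s < 1) (f : Hol) : supNorm r f ≤ supNorm s f :=
  supNorm_le (supNorm_nonneg s f) fun _ hz => norm_apply_le_supNorm hs f (hz.trans hrs)

theorem supNorm_smul (r : ℝ) (c : ℂ) (f : Hol) : supNorm r (c • f) = ‖c‖ * supNorm r f := by
  unfold supNorm
  rw [Real.mul_iSup_of_nonneg (norm_nonneg c)]
  simp

theorem supNorm_rotOp (r : ℝ) (α β : Circle) (f : Hol) : supNorm r (rotOp α β f) = supNorm r f := by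
  have key : ∀ (α β : Circle) (f : Hol), supNorm r (rotOp α β f) =
      ⨆ z : {z : 𝔻 // ‖(z : ℂ)‖ ≤ r}, ‖f.1 (β • z.1)‖ := fun α β f => by
    simp [supNorm, rotOp, Circle.norm_coe]
  rw [key]
  let e : {z : 𝔻 // ‖(z : ℂ)‖ ≤ r} ≃ {z : 𝔻 // ‖(z : ℂ)‖ ≤ r} :=
    (MulAction.toPerm β).subtypeEquiv fun z => by simp [Circle.norm_coe]
  exact e.iSup_congr fun z => rfl

theorem holNorm_nonneg (p : ℕ) (f : Hol) : 0 ≤ holNorm p f := supNorm_nonneg _ f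

theorem holNorm_smul (p : ℕ) (c : ℂ) (f : Hol) : holNorm p (c • f) = ‖c‖ * holNorm p f :=
  supNorm_smul _ c f

theorem holNorm_rotOp (p : ℕ) (α β : Circle) (f : Hol) : holNorm p (rotOp α β f) = holNorm p f :=
  supNorm_rotOp _ α β f

theorem monotone_holNorm_succ (f : Hol) : Monotone fun k : ℕ => holNorm (k + 1) f := by
  intro j k hjk
  refine supNorm_mono ?_ ?_ f
  · gcongr
  · have : (0 : ℝ) < 1 / ((k + 1 : ℕ) : ℝ) := by positivity
    linarith

/-! ### Uniqueness, maximum principle and Schwarz lemma -/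

/-- Two holomorphic functions on the disc that agree on a circle are equal. -/
theorem ext_of_sphere {r : ℝ} (h0 : 0 < r) (h1 : r < 1) {f g : Hol}
    (h : ∀ z : 𝔻, ‖(z : ℂ)‖ = r → f.1 z = g.1 z) : f = g := by
  obtain ⟨F, hF, hf⟩ := f.2
  obtain ⟨G, hG, hg⟩ := g.2
  have hsub : closure (Metric.ball (0 : ℂ) r) ⊆ Metric.ball 0 1 :=
    Metric.closure_ball_subset_closedBall.trans (Metric.closedBall_subset_ball h1)
  have hball : Set.EqOn F G (Metric.ball 0 r) := by
    refine Complex.eqOn_of_eqOn_frontier Metric.isBounded_ball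
      (hF.mono hsub).diffContOnCl (hG.mono hsub).diffContOnCl ?_
    intro z hz
    rw [frontier_ball _ h0.ne', mem_sphere_zero_iff_norm] at hz
    simpa [hf, hg] using h (.mk z (hz.trans_lt h1)) (by simpa using hz)
  have hall : Set.EqOn F G (Metric.ball 0 1) :=
    (hF.analyticOnNhd Metric.isOpen_ball).eqOn_of_preconnected_of_eventuallyEq
      (hG.analyticOnNhd Metric.isOpen_ball) (convex_ball 0 1).isPreconnected
      (Metric.mem_ball_self one_pos)
      (Filter.eventuallyEq_of_mem (Metric.ball_mem_nhds 0 h0) hball)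
  ext z
  rw [hf, hg, hall (by simpa using z.norm_lt_one)]

/-- If `‖f‖` on a closed disc centred at `0` is at most `‖f 0‖`, then `f` is constant there. -/
theorem apply_eq_apply_zero {r : ℝ} (h1 : r < 1) {f : Hol} (h : supNorm r f ≤ ‖f.1 0‖) {z : 𝔻}
    (hz : ‖(z : ℂ)‖ ≤ r) : f.1 z = f.1 0 := by
  obtain ⟨F, hF, hf⟩ := f.2
  have hsub : closure (Metric.ball (0 : ℂ) r) ⊆ Metric.ball 0 1 :=
    Metric.closure_ball_subset_closedBall.trans (Metric.closedBall_subset_ball h1)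
  have hmax : IsMaxOn (norm ∘ F) (Metric.ball 0 r) 0 := by
    intro w hw
    rw [mem_ball_zero_iff] at hw
    have := (norm_apply_le_supNorm h1 f (z := .mk w (hw.trans h1)) (by simpa using hw.le)).trans h
    simpa [hf] using this
  simpa [hf] using
    Complex.eqOn_closedBall_of_isMaxOn_norm (hF.mono hsub).diffContOnCl hmax (by simpa using hz)

/-- Equality in the Schwarz lemma: a holomorphic function vanishing at `0` whose supremum over the
discs of radii `r < s` equals the radius is a rotation on the smaller disc. -/
theorem exists_circle_apply_eq_mul {r s : ℝ} (h0 : 0 < r) (hrs : r < s) (h1 : s < 1) {f : Hol}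
    (hf0 : f.1 0 = 0) (hr : supNorm r f = r) (hs : supNorm s f ≤ s) :
    ∃ β : Circle, ∀ z : 𝔻, ‖(z : ℂ)‖ ≤ r → f.1 z = β * z := by
  obtain ⟨F, hF, hf⟩ := f.2
  have hF0 : F 0 = 0 := by simpa [hf] using hf0
  have hFs : DifferentiableOn ℂ F (Metric.ball 0 s) := hF.mono (Metric.ball_subset_ball h1.le)
  have hmaps : Set.MapsTo F (Metric.ball 0 s) (Metric.closedBall (F 0) s) := by
    intro w hw
    rw [mem_ball_zero_iff] at hw
    have := (norm_apply_le_supNorm h1 f (z := .mk w (hw.trans h1)) (by simpa using hw.le)).trans hs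
    simpa [hF0, hf] using this
  obtain ⟨w, hw, hwmax⟩ := (isCompact_closedBall (0 : ℂ) r).exists_isMaxOn
    ⟨0, Metric.mem_closedBall_self h0.le⟩
    (hF.continuousOn.mono (Metric.closedBall_subset_ball (hrs.trans h1))).norm
  rw [mem_closedBall_zero_iff] at hw
  have hFw : r ≤ ‖F w‖ := by
    rw [← hr]
    refine supNorm_le (norm_nonneg _) fun z hz => ?_
    rw [hf]
    exact hwmax (by simpa using hz)
  have hws : w ∈ Metric.ball (0 : ℂ) s := by simpa using hw.trans_lt hrs
  have hFw' : ‖F w‖ ≤ ‖w‖ :=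
    Complex.norm_le_norm_of_mapsTo_ball hFs (by rwa [hF0] at hmaps) hF0 (by simpa using hws)
  have hwr : ‖w‖ = r := le_antisymm hw (hFw.trans hFw')
  have hFwr : ‖F w‖ = r := le_antisymm (hFw'.trans hw) hFw
  have hw0 : w ≠ 0 := by rw [← norm_pos_iff, hwr]; exact h0
  have hs0 : s ≠ 0 := (h0.trans hrs).ne'
  -- Since `r < s`, the point `w` is interior to the disc of radius `s`, where equality in the
  -- Schwarz lemma is rigid.
  have hslope : ‖dslope F 0 w‖ = 1 := by
    rw [dslope_of_ne _ hw0, slope_def_module, hF0]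
    simp [hwr, hFwr, h0.ne']
  have haff := Complex.affine_of_mapsTo_ball_of_norm_dslope_eq_div hFs hmaps hws
    (by rw [hslope, div_self hs0])
  refine ⟨⟨dslope F 0 w, mem_sphere_zero_iff_norm.2 hslope⟩, fun z hz => ?_⟩
  have := haff (x := z) (by simpa using hz.trans_lt hrs)
  simpa [hF0, hf, mul_comm] using this

/-! ### Peak functions and evaluation functionals -/

/-- The constant function `1`. -/
def const : Hol := ⟨fun _ => 1, fun _ => 1, differentiableOn_const 1, fun _ => rfl⟩

/-- The coordinate function `z`. -/
def coord : Hol := ⟨fun z => z, id, differentiableOn_id, fun _ => rfl⟩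

theorem supNorm_const {r : ℝ} (h0 : 0 ≤ r) : supNorm r const = 1 := by
  have : Nonempty {z : 𝔻 // ‖(z : ℂ)‖ ≤ r} := ⟨0, by simpa⟩
  simp [supNorm, const]

theorem supNorm_coord {r : ℝ} (h0 : 0 ≤ r) (h1 : r < 1) : supNorm r coord = r := by
  refine le_antisymm (supNorm_le h0 fun z hz => hz) ?_
  have hr : ‖(r : ℂ)‖ = r := by simp [abs_of_nonneg h0]
  simpa [coord, hr, abs_of_nonneg h0] using
    norm_apply_le_supNorm h1 coord (z := .mk r (hr.trans_lt h1)) (by simp [abs_of_nonneg h0])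

/-- Quantitative peaking at `a`: with `u` the second summand, `‖1 - u‖ = ‖z - a‖ / r`, and the
parallelogram law turns this into a loss for `‖1 + u‖`. -/
theorem norm_one_add_le {r ε : ℝ} (hr : 0 < r) (hε : 0 ≤ ε) {a z : ℂ} (ha : ‖a‖ = r) (hz : ‖z‖ ≤ r)
    (hza : ε ≤ ‖z - a‖) (h : ε ≤ 2 * r) :
    ‖1 + (starRingEnd ℂ a / (r : ℂ) ^ 2) * z‖ ≤ 2 - ε ^ 2 / (4 * r ^ 2) := by
  have hr' : (r : ℂ) ≠ 0 := by exact_mod_cast hr.ne'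
  set u : ℂ := (starRingEnd ℂ a / (r : ℂ) ^ 2) * z with hu
  have hunorm : ‖u‖ = ‖z‖ / r := by
    rw [hu, norm_mul, norm_div, RCLike.norm_conj, ha, norm_pow, Complex.norm_real,
      Real.norm_of_nonneg hr.le]
    field_simp
  have hu1 : ‖u‖ ≤ 1 := by rw [hunorm]; exact (div_le_one hr).2 hz
  have hsub : 1 - u = (starRingEnd ℂ a / (r : ℂ) ^ 2) * (a - z) := by
    have : starRingEnd ℂ a * a = (r : ℂ) ^ 2 := by rw [Complex.conj_mul', ha]
    rw [mul_sub, ← hu, div_mul_eq_mul_div, this, div_self (pow_ne_zero 2 hr')]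
  have hsubnorm : ‖1 - u‖ = ‖z - a‖ / r := by
    rw [hsub, norm_mul, norm_div, RCLike.norm_conj, ha, norm_pow, Complex.norm_real,
      Real.norm_of_nonneg hr.le, norm_sub_rev]
    field_simp
  have hpar := parallelogram_law_with_norm ℝ (1 : ℂ) u
  have hge : (ε / r) ^ 2 ≤ ‖1 - u‖ ^ 2 := by rw [hsubnorm]; gcongr
  have hη : ε ^ 2 / (4 * r ^ 2) = (ε / r) ^ 2 / 4 := by field_simp
  have hle : (ε / r) ^ 2 ≤ 2 ^ 2 := by
    gcongr
    rwa [div_le_iff₀ hr]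
  rw [hη]
  refine abs_le_of_sq_le_sq' ?_ (by linarith) |>.2
  rw [norm_one] at hpar
  nlinarith [norm_nonneg u, sq_nonneg ((ε / r) ^ 2)]

/-- A unital functional that is contractive for the supremum over the closed disc of radius `r` and
sends the coordinate function to a point `a` of the boundary circle is evaluation at `a`. -/
theorem functional_eq_eval {r : ℝ} (h0 : 0 < r) (h1 : r < 1) (φ : Hol →ₗ[ℂ] ℂ)
    (hφ : ∀ f, ‖φ f‖ ≤ supNorm r f) (hconst : φ const = 1) {a : 𝔻} (ha : ‖(a : ℂ)‖ = r)
    (hcoord : φ coord = a) (f : Hol) : φ f = f.1 a := by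
  set h : Hol := f - f.1 a • const with hh
  suffices hφh : φ h = 0 by
    rw [hh, map_sub, map_smul, hconst, smul_eq_mul, mul_one] at hφh
    exact sub_eq_zero.1 hφh
  have hha : h.1 a = 0 := by simp [hh, const]
  rw [← norm_le_zero_iff]
  refine le_of_forall_pos_le_add fun δ hδ => ?_
  rw [zero_add]
  obtain ⟨F, hF, hf⟩ := h.2
  have hFa : F a = 0 := by rw [← hf, hha]
  have hcont : ContinuousAt F a := hF.continuousOn.continuousAt
    (Metric.isOpen_ball.mem_nhds (by simpa using a.norm_lt_one))
  obtain ⟨ε', hε', hnear'⟩ := Metric.continuousAt_iff.1 hcont δ hδ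
  obtain ⟨ε, hε, hεε', hεr⟩ : ∃ ε > 0, ε ≤ ε' ∧ ε ≤ 2 * r :=
    ⟨min ε' (2 * r), by positivity, min_le_left _ _, min_le_right _ _⟩
  set η : ℝ := ε ^ 2 / (4 * r ^ 2) with hη
  have hη0 : 0 < η := by positivity
  set K := supNorm r h
  have hK : 0 ≤ K := supNorm_nonneg r h
  -- Chosen so that `M * η = K`: at distance at least `ε` from `a`, the loss of `M` times the peak
  -- function absorbs `|h| ≤ K`.
  set M : ℝ := K / η
  have hM : 0 ≤ M := by positivity
  have hr' : (r : ℂ) ≠ 0 := by exact_mod_cast h0.ne'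
  obtain ⟨c, hc, hcφ⟩ : ∃ c : ℂ, ‖c‖ = 1 ∧ ‖φ h‖ = c * φ h := by
    obtain ⟨c, hc, hcφ⟩ := RCLike.exists_norm_eq_mul_self (φ h)
    exact ⟨c, hc, by simpa using hcφ⟩
  -- `φ e = 2M + ‖φ h‖`, while `|e| ≤ 2M + δ` on the disc, by smallness of `h` near `a` and by the
  -- choice of `M` elsewhere.
  set e : Hol := (M : ℂ) • (const + (starRingEnd ℂ (a : ℂ) / (r : ℂ) ^ 2) • coord) + c • h with he
  have hφe : φ e = ((2 * M + ‖φ h‖ : ℝ) : ℂ) := by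
    have haa : starRingEnd ℂ (a : ℂ) * a = (r : ℂ) ^ 2 := by rw [Complex.conj_mul', ha]
    simp only [he, map_add, map_smul, hconst, hcoord, smul_eq_mul]
    rw [div_mul_eq_mul_div, haa, div_self (pow_ne_zero 2 hr'), ← hcφ]
    push_cast
    ring
  have hle : supNorm r e ≤ 2 * M + δ := by
    refine supNorm_le (by positivity) fun z hz => ?_
    have hez : e.1 z = M * (1 + (starRingEnd ℂ (a : ℂ) / (r : ℂ) ^ 2) * z) + c * h.1 z := rfl
    have hbound : ‖e.1 z‖ ≤
        M * ‖1 + (starRingEnd ℂ (a : ℂ) / (r : ℂ) ^ 2) * z‖ + ‖h.1 z‖ := by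
      rw [hez]
      refine (norm_add_le _ _).trans_eq ?_
      rw [norm_mul, norm_mul, hc, one_mul, Complex.norm_real, Real.norm_of_nonneg hM]
    rcases lt_or_ge ‖(z : ℂ) - a‖ ε with hlt | hge
    · have h2 := norm_one_add_le (a := a) (z := z) h0 le_rfl ha hz (norm_nonneg _) (by positivity)
      have h3 : ‖h.1 z‖ < δ := by
        have := hnear' (x := z) (by rw [dist_eq_norm]; exact hlt.trans_le hεε')
        rwa [hFa, dist_zero_right, ← hf] at this
      have h4 := mul_le_mul_of_nonneg_left h2 hM
      simp only [ne_eq, OfNat.ofNat_ne_zero, not_false_eq_true, zero_pow, zero_div, sub_zero] at h4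
      linarith
    · have h2 := mul_le_mul_of_nonneg_left (norm_one_add_le h0 hε.le ha hz hge hεr) hM
      have h3 := norm_apply_le_supNorm h1 h hz
      have h4 : M * η = K := div_mul_cancel₀ K hη0.ne'
      rw [← hη, mul_sub, h4] at h2
      linarith
  have := (hφ e).trans hle
  rw [hφe, Complex.norm_real, Real.norm_of_nonneg (by positivity)] at this
  linarith

/-! ### Rigidity of operators preserving three suprema -/

/-- A linear operator preserving the suprema over the discs of radii `0`, `r` and `s`, where
`0 < r < s < 1`, has the form `f ↦ α f(β ·)`. -/
theorem exists_eq_rotOp {r s : ℝ} (h0 : 0 < r) (hrs : r < s) (h1 : s < 1) (T : Hol →ₗ[ℂ] Hol)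
    (hT0 : ∀ f, supNorm 0 (T f) = supNorm 0 f) (hTr : ∀ f, supNorm r (T f) = supNorm r f)
    (hTs : ∀ f, supNorm s (T f) = supNorm s f) : ∃ α β : Circle, T = rotOp α β := by
  have hr1 : r < 1 := hrs.trans h1
  have hzero : ∀ f : Hol, supNorm 0 f = ‖f.1 0‖ := fun f => by
    refine le_antisymm (supNorm_le (norm_nonneg _) fun z hz => ?_)
      (norm_apply_le_supNorm one_pos f (by simp))
    have : z = 0 := by simpa using hz
    rw [this]
  simp only [hzero] at hT0
  have hα : ‖(T const).1 0‖ = 1 := by rw [hT0]; simp [const]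
  obtain ⟨β, hβ⟩ : ∃ β : Circle, ∀ z : 𝔻, ‖(z : ℂ)‖ ≤ r →
      ((T const).1 0)⁻¹ * (T coord).1 z = β * z := by
    refine exists_circle_apply_eq_mul (f := ((T const).1 0)⁻¹ • T coord) h0 hrs h1 ?_ ?_ ?_
    · have : (T coord).1 0 = 0 := by simpa [coord] using hT0 coord
      simp [this]
    · rw [supNorm_smul, hTr, supNorm_coord h0.le hr1, norm_inv, hα, inv_one, one_mul]
    · rw [supNorm_smul, hTs, supNorm_coord (h0.trans hrs).le h1, norm_inv, hα, inv_one, one_mul]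
  have hne : (T const).1 0 ≠ 0 := by rw [← norm_pos_iff, hα]; exact one_pos
  refine ⟨⟨(T const).1 0, mem_sphere_zero_iff_norm.2 hα⟩, β, LinearMap.ext fun f => ?_⟩
  refine ext_of_sphere h0 hr1 fun z hz => ?_
  let φ : Hol →ₗ[ℂ] ℂ :=
    ((T const).1 0)⁻¹ • (LinearMap.proj z ∘ₗ Hol.subtype ∘ₗ T : Hol →ₗ[ℂ] ℂ)
  have hφ : ∀ g, φ g = ((T const).1 0)⁻¹ * (T g).1 z := fun g => rfl
  have key : φ f = f.1 (β • z) := by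
    refine functional_eq_eval h0 hr1 φ (fun g => ?_) ?_ ?_ ?_ f
    · rw [hφ, norm_mul, norm_inv, hα, inv_one, one_mul, ← hTr]
      exact norm_apply_le_supNorm hr1 _ hz.le
    · have h2 : supNorm r (T const) ≤ ‖(T const).1 0‖ := by rw [hTr, supNorm_const h0.le, hα]
      rw [hφ, apply_eq_apply_zero hr1 h2 hz.le, inv_mul_cancel₀ hne]
    · simpa [Circle.norm_coe] using hz
    · rw [hφ, hβ z hz.le, Complex.UnitDisc.coe_circle_smul]
  rw [hφ, inv_mul_eq_iff_eq_mul₀ hne] at key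
  exact key

end Hol

/-! ### Recovering the seminorms from the metrics -/

theorem summable_half_pow_succ : Summable fun k : ℕ => (1 / 2 : ℝ) ^ (k + 1) :=
  (summable_nat_add_iff 1).2 summable_geometric_two

theorem tsum_half_pow_succ : ∑' k : ℕ, (1 / 2 : ℝ) ^ (k + 1) = 1 := by
  simp_rw [pow_succ]
  rw [tsum_mul_right, tsum_geometric_two]
  norm_num

theorem summable_half_pow_succ_mul {u : ℕ → ℝ} {C : ℝ} (hu : ∀ k, |u k| ≤ C) :
    Summable fun k : ℕ => (1 / 2 : ℝ) ^ (k + 1) * u k := by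
  refine Summable.of_norm_bounded (summable_half_pow_succ.mul_right C) fun k => ?_
  rw [norm_mul, Real.norm_of_nonneg (by positivity), Real.norm_eq_abs]
  gcongr
  exact hu k

/-- At `t = 1 / b k` every `b`-term from index `k` on is saturated, so `a k < b k` would make the
`a`-sum strictly smaller. -/
theorem le_of_tsum_min_eq {a b : ℕ → ℝ} (ha : ∀ k, 0 ≤ a k) (hb : Monotone b)
    (h : ∀ t : ℝ, 0 < t → ∑' k : ℕ, (1 / 2 : ℝ) ^ (k + 1) * min 1 (t * a k) =
      ∑' k : ℕ, (1 / 2 : ℝ) ^ (k + 1) * min 1 (t * b k))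
    (hb0 : ∀ k, 0 ≤ b k) {k : ℕ} (hk : ∀ j < k, a j = b j) : b k ≤ a k := by
  by_contra! hlt
  have hbk : 0 < b k := (ha k).trans_lt hlt
  have hsum : ∀ c : ℕ → ℝ, (∀ k, 0 ≤ c k) →
      Summable fun j : ℕ => (1 / 2 : ℝ) ^ (j + 1) * min 1 ((b k)⁻¹ * c j) := fun c hc =>
    summable_half_pow_succ_mul (C := 1) fun j => by
      rw [abs_of_nonneg (le_min zero_le_one (mul_nonneg (by positivity) (hc j)))]
      exact min_le_left _ _
  refine (Summable.tsum_lt_tsum (i := k) (fun j => ?_) ?_ (hsum a ha) (hsum b hb0)).ne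
    (h (b k)⁻¹ (inv_pos.2 hbk))
  · rcases lt_or_ge j k with hj | hj
    · rw [hk j hj]
    · have : 1 ≤ (b k)⁻¹ * b j := by
        rw [inv_mul_eq_div, one_le_div hbk]
        exact hb hj
      rw [min_eq_left this]
      gcongr
      exact min_le_left _ _
  · have : (b k)⁻¹ * a k < 1 := by rwa [inv_mul_eq_div, div_lt_one hbk]
    rw [inv_mul_cancel₀ hbk.ne', min_self]
    gcongr
    exact (min_le_right _ _).trans_lt this

/-- With `s = 1 / t` the difference of the sums is `s` times `∑ 2^{-(j+1)} (1/(s + a j) - 1/(s + b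
j))`. Terms with `j < k` cancel, so this continues analytically to `Re s > -a k` and vanishes there.
If `a k < b k`, its `k`-th term blows up as `s → -a k`, while the negative parts stay bounded. -/
theorem le_of_tsum_div_one_add_eq {a b : ℕ → ℝ} (ha : ∀ k, 0 ≤ a k) (hb0 : ∀ k, 0 ≤ b k)
    (ham : Monotone a) (hb : Monotone b)
    (h : ∀ t : ℝ, 0 < t → ∑' k : ℕ, (1 / 2 : ℝ) ^ (k + 1) * (t * a k / (1 + t * a k)) =
      ∑' k : ℕ, (1 / 2 : ℝ) ^ (k + 1) * (t * b k / (1 + t * b k)))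
    {k : ℕ} (hk : ∀ j < k, a j = b j) : b k ≤ a k := by
  by_contra! hlt
  set d := b k - a k with hd
  have hd0 : 0 < d := sub_pos.2 hlt
  -- `ε < 1` puts `1` in the half-plane `U`; the other bound makes the `k`-th term too large at `s =
  -- 2ε - a k`.
  obtain ⟨ε, hε, hε1, hεd⟩ : ∃ ε > 0, ε < 1 ∧ ε ≤ (1 / 2 : ℝ) ^ (k + 1) * d / 4 :=
    ⟨min (1 / 2) ((1 / 2 : ℝ) ^ (k + 1) * d / 4), by positivity,
      (min_le_left _ _).trans_lt (by norm_num), min_le_right _ _⟩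
  let D : ℕ → ℂ → ℂ := fun j z => (1 / 2 : ℂ) ^ (j + 1) * (1 / (z + a j) - 1 / (z + b j))
  let E : ℕ → ℝ → ℝ := fun j s => (1 / 2 : ℝ) ^ (j + 1) * (1 / (s + a j) - 1 / (s + b j))
  have hDE : ∀ j (s : ℝ), D j s = (E j s : ℂ) := fun j s => by simp [D, E]
  let U : Set ℂ := {z | ε - a k < z.re}
  have hUo : IsOpen U := isOpen_lt continuous_const Complex.continuous_re
  have hUc : IsPreconnected U := (convex_halfSpace_re_gt _).isPreconnected
  have hre : ∀ z ∈ U, ∀ x : ℝ, a k ≤ x → ε ≤ ‖z + x‖ := by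
    intro z hz x hx
    refine le_trans ?_ (Complex.re_le_norm _)
    have hz' : ε - a k < z.re := hz
    simp only [Complex.add_re, Complex.ofReal_re]
    linarith
  have hne : ∀ z ∈ U, ∀ x : ℝ, a k ≤ x → z + x ≠ 0 := fun z hz x hx =>
    norm_pos_iff.1 (hε.trans_le (hre z hz x hx))
  have hbnd : ∀ z ∈ U, ∀ x : ℝ, a k ≤ x → ‖1 / (z + x)‖ ≤ 1 / ε := fun z hz x hx => by
    rw [norm_div, norm_one]
    exact one_div_le_one_div_of_le hε (hre z hz x hx)
  have hab : ∀ j, k ≤ j → a k ≤ a j ∧ a k ≤ b j := fun j hj => ⟨ham hj, hlt.le.trans (hb hj)⟩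
  have hDdiff : DifferentiableOn ℂ (fun z => ∑' j, D j z) U := by
    refine Complex.differentiableOn_tsum_of_summable_norm
      (summable_half_pow_succ.mul_right (1 / ε + 1 / ε)) (fun j => ?_) hUo fun j z hz => ?_
    · rcases lt_or_ge j k with hj | hj
      · simp only [D, hk j hj, sub_self, mul_zero]
        exact differentiableOn_const 0
      · obtain ⟨h1, h2⟩ := hab j hj
        exact (((differentiableOn_const 1).div (differentiableOn_id.add_const _)
          fun z hz => hne z hz _ h1).sub ((differentiableOn_const 1).div
          (differentiableOn_id.add_const _) fun z hz => hne z hz _ h2)).const_mul _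
    · have hw : ‖(1 / 2 : ℂ) ^ (j + 1)‖ = (1 / 2 : ℝ) ^ (j + 1) := by simp
      rcases lt_or_ge j k with hj | hj
      · simp only [D, hk j hj, sub_self, mul_zero, norm_zero]
        positivity
      · obtain ⟨h1, h2⟩ := hab j hj
        rw [norm_mul, hw]
        gcongr
        exact (norm_sub_le _ _).trans (add_le_add (hbnd z hz _ h1) (hbnd z hz _ h2))
  have hpos : ∀ s : ℝ, 0 < s → ∑' j, D j s = 0 := by
    intro s hs
    have hsum : ∀ c : ℕ → ℝ, (∀ k, 0 ≤ c k) →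
        Summable fun j : ℕ => (1 / 2 : ℝ) ^ (j + 1) * (s⁻¹ * c j / (1 + s⁻¹ * c j)) := fun c hc =>
      summable_half_pow_succ_mul (C := 1) fun j => by
        have : 0 ≤ s⁻¹ * c j := mul_nonneg (by positivity) (hc j)
        rw [abs_of_nonneg (by positivity), div_le_one (by positivity)]
        linarith
    have hzero := (hsum b hb0).tsum_sub (hsum a ha)
    rw [h s⁻¹ (inv_pos.2 hs), sub_self] at hzero
    simp_rw [hDE]
    rw [← Complex.ofReal_tsum, Complex.ofReal_eq_zero]
    have hterm : ∀ j, E j s = s⁻¹ * ((1 / 2 : ℝ) ^ (j + 1) * (s⁻¹ * b j / (1 + s⁻¹ * b j)) -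
        (1 / 2 : ℝ) ^ (j + 1) * (s⁻¹ * a j / (1 + s⁻¹ * a j))) := by
      intro j
      have h1 : s + a j ≠ 0 := (add_pos_of_pos_of_nonneg hs (ha j)).ne'
      have h2 : s + b j ≠ 0 := (add_pos_of_pos_of_nonneg hs (hb0 j)).ne'
      have hx : ∀ x : ℝ, s + x ≠ 0 → s⁻¹ * x / (1 + s⁻¹ * x) = x / (s + x) := by
        intro x hx
        have : 1 + s⁻¹ * x ≠ 0 := by
          intro h0
          apply hx
          field_simp at h0
          simpa using h0
        field_simp
      simp only [E]
      rw [hx _ h1, hx _ h2]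
      field_simp
      ring
    simp_rw [hterm]
    rw [tsum_mul_left, hzero, mul_zero]
  have h1U : (1 : ℂ) ∈ U := by
    simp only [U, Set.mem_ofPred_eq, Complex.one_re]
    linarith [ha k]
  have hfreq : ∃ᶠ z in nhdsWithin (1 : ℂ) {1}ᶜ, ∑' j, D j z = 0 := by
    have ht : Filter.Tendsto (fun n : ℕ => ((1 + 1 / ((n : ℝ) + 1) : ℝ) : ℂ)) Filter.atTop
        (nhdsWithin (1 : ℂ) {1}ᶜ) := by
      refine tendsto_nhdsWithin_iff.2 ⟨?_, Filter.Eventually.of_forall fun n => ?_⟩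
      · have := (tendsto_one_div_add_atTop_nhds_zero_nat (𝕜 := ℝ)).const_add 1
        rw [add_zero] at this
        simpa [Function.comp_def] using (Complex.continuous_ofReal.tendsto 1).comp this
      · have : (1 + 1 / ((n : ℝ) + 1) : ℝ) ≠ 1 := by
          have : 0 < 1 / ((n : ℝ) + 1) := by positivity
          linarith
        simpa only [Set.mem_compl_iff, Set.mem_singleton_iff, Complex.ofReal_eq_one] using this
    exact ht.frequently (Filter.Frequently.of_forall fun n => hpos _ (by positivity))
  have hzeroU := (hDdiff.analyticOnNhd hUo).eqOn_zero_of_preconnected_of_frequently_eq_zero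
    hUc h1U hfreq
  set s : ℝ := 2 * ε - a k with hs
  have hsU : (s : ℂ) ∈ U := by
    simp only [U, Set.mem_ofPred_eq, Complex.ofReal_re, hs]
    linarith
  have hEs : ∑' j, E j s = 0 := by
    have := hzeroU hsU
    simp only [hDE, Pi.zero_apply] at this
    rwa [← Complex.ofReal_tsum, Complex.ofReal_eq_zero] at this
  have hEsum : Summable fun j => E j s := by
    refine summable_half_pow_succ_mul (C := 1 / ε + 1 / ε) fun j => ?_
    rcases lt_or_ge j k with hj | hj
    · simp only [hk j hj, sub_self, abs_zero]
      positivity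
    · obtain ⟨h1, h2⟩ := hab j hj
      have := (norm_sub_le _ _).trans (add_le_add (hbnd s hsU _ h1) (hbnd s hsU _ h2))
      exact_mod_cast this
  have hlow : ∀ j, k ≤ j → 1 / (s + b j) ≤ 1 / d := fun j hj =>
    one_div_le_one_div_of_le hd0 (by linarith [hb hj])
  -- Adding weights of total mass `1 / d` makes all terms nonnegative, so the `k`-th is at most the
  -- total.
  have hnn : ∀ j, 0 ≤ E j s + (1 / 2 : ℝ) ^ (j + 1) * (1 / d) := by
    intro j
    rw [← mul_add]
    refine mul_nonneg (by positivity) ?_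
    rcases lt_or_ge j k with hj | hj
    · simp only [hk j hj, sub_self, zero_add]
      positivity
    · have : 0 < 1 / (s + a j) := one_div_pos.2 (by linarith [ham hj])
      linarith [hlow j hj]
  have htot := (hEsum.add (summable_half_pow_succ.mul_right (1 / d))).le_tsum k fun j _ => hnn j
  rw [hEsum.tsum_add (summable_half_pow_succ.mul_right (1 / d)), hEs, tsum_mul_right,
    tsum_half_pow_succ, zero_add, one_mul, ← mul_add] at htot
  have hsa : s + a k = 2 * ε := by rw [hs]; ring
  have h3 : (1 / 2 : ℝ) ^ (k + 1) * (1 / (2 * ε)) ≤ 1 / d := by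
    refine le_trans ?_ htot
    rw [hsa]
    gcongr
    linarith [hlow k le_rfl]
  rw [mul_one_div, div_le_div_iff₀ (by positivity) hd0] at h3
  have : 0 < (1 / 2 : ℝ) ^ (k + 1) * d := by positivity
  linarith

/-! ### From isometries to rotations -/

namespace Hol

theorem holNorm_succ_eq_of_holDist {f g : Hol}
    (h : ∀ c : ℂ, holDist (c • f) 0 = holDist (c • g) 0) (k : ℕ) :
    holNorm (k + 1) f = holNorm (k + 1) g := by
  have key : ∀ t : ℝ, 0 < t → ∑' k : ℕ, (1 / 2 : ℝ) ^ (k + 1) * min 1 (t * holNorm (k + 1) f) =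
      ∑' k : ℕ, (1 / 2 : ℝ) ^ (k + 1) * min 1 (t * holNorm (k + 1) g) := fun t ht => by
    simpa [holDist, holNorm_smul, abs_of_pos ht] using h t
  induction k using Nat.strong_induction_on with
  | _ k ih =>
    exact le_antisymm
      (le_of_tsum_min_eq (fun _ => holNorm_nonneg _ g) (monotone_holNorm_succ f)
        (fun t ht => (key t ht).symm) (fun _ => holNorm_nonneg _ f) fun j hj => (ih j hj).symm)
      (le_of_tsum_min_eq (fun _ => holNorm_nonneg _ f) (monotone_holNorm_succ g) key
        (fun _ => holNorm_nonneg _ g) ih)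

theorem holNorm_succ_eq_of_holDist' {f g : Hol}
    (h : ∀ c : ℂ, holDist' (c • f) 0 = holDist' (c • g) 0) (k : ℕ) :
    holNorm (k + 1) f = holNorm (k + 1) g := by
  have key : ∀ t : ℝ, 0 < t →
      ∑' k : ℕ, (1 / 2 : ℝ) ^ (k + 1) *
        (t * holNorm (k + 1) f / (1 + t * holNorm (k + 1) f)) =
      ∑' k : ℕ, (1 / 2 : ℝ) ^ (k + 1) *
        (t * holNorm (k + 1) g / (1 + t * holNorm (k + 1) g)) := fun t ht => by
    simpa [holDist', holNorm_smul, abs_of_pos ht] using h t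
  induction k using Nat.strong_induction_on with
  | _ k ih =>
    exact le_antisymm
      (le_of_tsum_div_one_add_eq (fun _ => holNorm_nonneg _ g) (fun _ => holNorm_nonneg _ f)
        (monotone_holNorm_succ g) (monotone_holNorm_succ f)
        (fun t ht => (key t ht).symm) fun j hj => (ih j hj).symm)
      (le_of_tsum_div_one_add_eq (fun _ => holNorm_nonneg _ f) (fun _ => holNorm_nonneg _ g)
        (monotone_holNorm_succ f) (monotone_holNorm_succ g) key ih)

theorem exists_eq_rotOp_of_holNorm (T : Hol →ₗ[ℂ] Hol)
    (h : ∀ p : ℕ, 1 ≤ p → ∀ f : Hol, holNorm p (T f) = holNorm p f) :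
    ∃ α β : Circle, T = rotOp α β := by
  -- `p = 1, 2, 3` suffice: radii `0`, `1/2` and `2/3`.
  refine exists_eq_rotOp (r := 1 - 1 / ((2 : ℕ) : ℝ)) (s := 1 - 1 / ((3 : ℕ) : ℝ))
    (by norm_num) (by norm_num) (by norm_num) T (fun f => ?_) (h 2 (by norm_num))
    (h 3 (by norm_num))
  simpa [holNorm] using h 1 le_rfl f

end Hol

theorem mainTheorem2 (T : Hol →ₗ[ℂ] Hol) :
    ((∀ f g : Hol, holDist (T f) (T g) = holDist f g) ↔
      ∃ α β : Circle, T = rotOp α β) ∧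
    ((∀ f g : Hol, holDist' (T f) (T g) = holDist' f g) ↔
      ∃ α β : Circle, T = rotOp α β) ∧
    ((∀ p : ℕ, 1 ≤ p → ∀ f : Hol, holNorm p (T f) = holNorm p f) ↔
      ∃ α β : Circle, T = rotOp α β) := by
  refine ⟨⟨fun h => ?_, ?_⟩, ⟨fun h => ?_, ?_⟩, ⟨Hol.exists_eq_rotOp_of_holNorm T, ?_⟩⟩
  · refine Hol.exists_eq_rotOp_of_holNorm T fun p hp f => ?_
    obtain ⟨k, rfl⟩ := Nat.exists_eq_add_of_le' hp
    exact Hol.holNorm_succ_eq_of_holDist (fun c => by simpa using h (c • f) 0) k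
  · rintro ⟨α, β, rfl⟩ f g
    simp only [holDist, ← map_sub, Hol.holNorm_rotOp]
  · refine Hol.exists_eq_rotOp_of_holNorm T fun p hp f => ?_
    obtain ⟨k, rfl⟩ := Nat.exists_eq_add_of_le' hp
    exact Hol.holNorm_succ_eq_of_holDist' (fun c => by simpa using h (c • f) 0) k
  · rintro ⟨α, β, rfl⟩ f g
    simp only [holDist', ← map_sub, Hol.holNorm_rotOp]
  · rintro ⟨α, β, rfl⟩ p - f
    exact Hol.holNorm_rotOp p α β f
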